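/- Let $R$ be a reduced irreducible (crystallographic) root system of rank $r$ in a finite-dimensional vector space over $\mathbb{Q}$, with a fixed base $\alpha_1,\dots,\alpha_r$, positive roots $R^+$ and weight lattice $P$. For a root $\alpha=\sum_i k_i\alpha_i$ put $\operatorname{ht}\alpha=\sum_i k_i$. The exponents $d_1\le\dots\le d_r$ of $R$ are the parts of the partition dual to $m(1)\ge m(2)\ge\dots$, where $m(n)=\#\{\alpha\in R^+:\operatorname{ht}\alpha=n\}$. Let $m\ge1$ be an integer (for example one with $mP$ contained in the root lattice), let $q^{1/m}$ and $t$ be independent variables, $\mathbb{Q}_{q,t}=\mathbb{Q}(q^{1/m},t)$, and let $\mathbb{Q}_{q,t}[P]$ be the group algebra of $P$ with basis $e^\lambda$, $\lambda\in P$. The bar involution is $\mathbb{Q}_{q,t}$-linear with $\overline{e^\lambda}=e^{-\lambda}$; the involution $\iota$ fixes every $e^\lambda$ and acts on $\mathbb{Q}_{q,t}$ by $q^{1/m}\mapsto q^{-1/m}$, $t\mapsto t^{-1}$. Put $\chi(\alpha)=0$ for $\alpha\in R^+$ and $\chi(\alpha)=1$ for $-\alpha\in R^+$. Cherednik's scalar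 product is $$(f,g)_{q,t}=[\,f\,\bar g^{\,\iota}\,C_{q,t}]_0,\qquad f,g\in\mathbb{Q}_{q,t}[P],$$ where $[\ ]_0$ denotes the coefficient of $e^0$ and $$C_{q,t}=\prod_{\alpha\in R}\prod_{i=0}^{\infty}\frac{1-q^{i+\chi(\alpha)}e^{-\alpha}}{1-t^{-2}q^{i+\chi(\alpha)}e^{-\alpha}},$$ expanded as a formal power series in $q^{1/m}$ and $t^{-1}$ with coefficients in $\mathbb{Q}[P]$. Thus $C_{q,t}$ is the product of the factors $$\frac{q^{-(i+\chi(\alpha))/2}e^{\alpha/2}-q^{(i+\chi(\alpha))/2}e^{-\alpha/2}}{t\,q^{-(i+\chi(\alpha))/2}e^{\alpha/2}-t^{-1}q^{(i+\chi(\alpha))/2}e^{-\alpha/2}},$$ each multiplied by the scalar $t$ (a normalization that makes the infinite product converge formally). The values $(f,g)_{q,t}$ lie in the fraction field of $\mathbb{Q}[[q^{1/m},t^{-1}]]$, which contains $\mathbb{Q}_{q,t}$. Then for every positive root $\alpha$ $$(e^{-\alpha},1)_{q,t}=q\,t^{\,2\operatorname{ht}\alpha-2(d_r+1)}\,\frac{t^2-1}{q\,t^{-2d_r}-1}\,(1,1)_{q,t}.$$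 -/

import Mathlib

noncomputable section

namespace Cherednik

/-- The field `ℚ(q^{1/m}, t)`, written as the fraction field of a polynomial ring in two
independent variables: variable `0` is `q^{1/m}` and variable `1` is `t⁻¹`. -/
abbrev CoeffField : Type := FractionRing (MvPolynomial (Fin 2) ℚ)

/-- The two generators `q^{1/m}` (index `0`) and `t⁻¹` (index `1`) of `CoeffField`. -/
def gen (i : Fin 2) : CoeffField :=
  algebraMap (MvPolynomial (Fin 2) ℚ) CoeffField (MvPolynomial.X i)

/-- The element `q = (q^{1/m})^m`. -/
def q (m : ℕ) : CoeffField := gen 0 ^ m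

/-- The element `t`. -/
def t : CoeffField := (gen 1)⁻¹

theorem aeval_gen_inv_injective :
    Function.Injective
      (MvPolynomial.aeval (fun i => (gen i)⁻¹) : MvPolynomial (Fin 2) ℚ →ₐ[ℚ] CoeffField) := by
  have hg : AlgebraicIndependent ℚ gen :=
    (MvPolynomial.algebraicIndependent_X (Fin 2) ℚ).map'
      (f := IsScalarTower.toAlgHom ℚ (MvPolynomial (Fin 2) ℚ) CoeffField)
      (IsFractionRing.injective _ _)
  have h2 : (Cardinal.mk (Fin 2)) ≤ Algebra.trdeg ℚ CoeffField := hg.cardinalMk_le_trdeg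
  let B := Algebra.adjoin ℚ (Set.range fun i => (gen i)⁻¹)
  have hpol : ∀ p : MvPolynomial (Fin 2) ℚ,
      IsAlgebraic B (algebraMap (MvPolynomial (Fin 2) ℚ) CoeffField p) := by
    intro p
    induction p using MvPolynomial.induction_on with
    | C a =>
      have : algebraMap (MvPolynomial (Fin 2) ℚ) CoeffField (MvPolynomial.C a)
          = algebraMap B CoeffField (algebraMap ℚ B a) := by
        rw [← IsScalarTower.algebraMap_apply ℚ B CoeffField, ← MvPolynomial.algebraMap_eq,
          ← IsScalarTower.algebraMap_apply ℚ (MvPolynomial (Fin 2) ℚ) CoeffField]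
      rw [this]
      exact isAlgebraic_algebraMap _
    | add p r hp hr => rw [map_add]; exact hp.add hr
    | mul_X p i hp =>
      rw [map_mul]
      refine hp.mul ?_
      have : IsAlgebraic B ((gen i)⁻¹) :=
        isAlgebraic_algebraMap (A := CoeffField)
          (⟨(gen i)⁻¹, Algebra.subset_adjoin ⟨i, rfl⟩⟩ : B)
      exact IsAlgebraic.inv_iff.mp this
  have : Algebra.IsAlgebraic B CoeffField := by
    refine ⟨fun z => ?_⟩
    obtain ⟨x, y, -, rfl⟩ := IsFractionRing.div_surjective (A := MvPolynomial (Fin 2) ℚ) z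
    rw [div_eq_mul_inv]
    exact (hpol x).mul (IsAlgebraic.inv_iff.mpr (hpol y))
  exact (Algebra.IsAlgebraic.isTranscendenceBasis_of_le_trdeg_of_finite ℚ
    (fun i => (gen i)⁻¹) h2).1

/-- The involution `ι` of the coefficient field: `q^{1/m} ↦ q^{-1/m}`, `t ↦ t⁻¹`. -/
def iota : CoeffField →+* CoeffField :=
  IsFractionRing.lift (A := MvPolynomial (Fin 2) ℚ)
    (g := (MvPolynomial.aeval (fun i => (gen i)⁻¹) :
      MvPolynomial (Fin 2) ℚ →ₐ[ℚ] CoeffField).toRingHom)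
    aeval_gen_inv_injective

theorem iota_gen (i : Fin 2) : iota (gen i) = (gen i)⁻¹ := by
  unfold iota
  rw [show gen i = algebraMap (MvPolynomial (Fin 2) ℚ) CoeffField (MvPolynomial.X i) from rfl,
    IsFractionRing.lift_algebraMap]
  exact MvPolynomial.aeval_X _ i

instance : IsDomain (MvPowerSeries (Fin 2) ℚ) := NoZeroDivisors.to_isDomain _

/-- The field in which the scalar product takes its values: the fraction field of the ring
`ℚ[[q^{1/m}, t⁻¹]]` of formal power series (same variables as in `CoeffField`). -/
abbrev ValueField : Type := FractionRing (MvPowerSeries (Fin 2) ℚ)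

/-- The inclusion `ℚ(q^{1/m}, t) ⊆ Frac ℚ[[q^{1/m}, t⁻¹]]`. -/
def emb : CoeffField →+* ValueField :=
  IsFractionRing.map (A := MvPolynomial (Fin 2) ℚ) (B := MvPowerSeries (Fin 2) ℚ)
    (j := MvPolynomial.coeToMvPowerSeries.ringHom) (MvPolynomial.coe_injective (Fin 2) ℚ)

variable {ι E V : Type*} [AddCommGroup E] [Module ℚ E] [AddCommGroup V] [Module ℚ V]

/-- The weight lattice: all `x ∈ E` with `(x, α^∨) ∈ ℤ` for every root `α`. -/
def weightLattice (P : RootPairing ι ℚ E V) : AddSubgroup E where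
  carrier := {x | ∀ i, ∃ n : ℤ, P.toLinearMap x (P.coroot i) = n}
  zero_mem' := fun i => ⟨0, by simp⟩
  add_mem' := by
    intro x y hx hy i
    obtain ⟨a, ha⟩ := hx i
    obtain ⟨c, hc⟩ := hy i
    exact ⟨a + c, by simp [ha, hc]⟩
  neg_mem' := by
    intro x hx i
    obtain ⟨a, ha⟩ := hx i
    exact ⟨-a, by simp [ha]⟩

/-- A root, as an element of the weight lattice. -/
def rootWeight (P : RootPairing ι ℚ E V) [P.IsCrystallographic] (i : ι) : weightLattice P :=
  ⟨P.root i, fun j => by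
    obtain ⟨n, hn⟩ := P.exists_value (S := ℤ) i j
    exact ⟨n, hn.symm⟩⟩

/-- The "polynomials": the group algebra of the weight lattice over `ℚ(q^{1/m}, t)`. -/
abbrev Poly (P : RootPairing ι ℚ E V) : Type _ := AddMonoidAlgebra CoeffField (weightLattice P)

/-- The formal exponential `e^μ`. -/
def expo {P : RootPairing ι ℚ E V} (μ : weightLattice P) : Poly P := AddMonoidAlgebra.single μ 1

/-- The bar involution: linear over the coefficient field, `e^μ ↦ e^{-μ}`. -/
def bar {P : RootPairing ι ℚ E V} (f : Poly P) : Poly P :=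
  AddMonoidAlgebra.domCongr CoeffField CoeffField (AddEquiv.neg (weightLattice P)) f

/-- The involution `ι` on polynomials: it acts on coefficients and fixes every `e^μ`. -/
def iotaPoly {P : RootPairing ι ℚ E V} (f : Poly P) : Poly P :=
  AddMonoidAlgebra.mapRingHom (weightLattice P) iota f

/-- Formal power series in `q^{1/m}` (variable `0`) and `t⁻¹` (variable `1`) whose coefficients
are rational linear combinations of the exponentials `e^μ`. -/
abbrev Series (P : RootPairing ι ℚ E V) : Type _ :=
  MvPowerSeries (Fin 2) (AddMonoidAlgebra ℚ (weightLattice P))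

section Kernel

variable {P : RootPairing ι ℚ E V} [P.IsCrystallographic]

open Classical in
/-- `χ(α) = 0` for a positive root `α`, and `χ(α) = 1` for a negative one. -/
def chi (b : P.Base) (i : ι) : ℕ := if b.IsPos i then 0 else 1

/-- The monomial `q^{n + χ(α)} e^{-α}`. -/
def mono (m : ℕ) (b : P.Base) (i : ι) (n : ℕ) : Series P :=
  MvPowerSeries.monomial (Finsupp.single 0 (m * (n + chi b i)))
    (AddMonoidAlgebra.single (-rootWeight P i) 1)

/-- The factor `(1 - q^{n + χ(α)} e^{-α}) / (1 - t⁻² q^{n + χ(α)} e^{-α})`, expanded as a power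
series. It is `t` times the quotient of
`q^{-(n+χ(α))/2} e^{α/2} - q^{(n+χ(α))/2} e^{-α/2}` by
`t q^{-(n+χ(α))/2} e^{α/2} - t⁻¹ q^{(n+χ(α))/2} e^{-α/2}`; the constant scalar is removed from every
factor because the infinite product has no formal meaning otherwise. -/
def factor (m : ℕ) (b : P.Base) (i : ι) (n : ℕ) : Series P :=
  (1 - mono m b i n) *
    MvPowerSeries.invOfUnit (1 - MvPowerSeries.X 1 ^ 2 * mono m b i n) 1

/-- The denominator really is inverted. -/
theorem factor_mul (m : ℕ) (b : P.Base) (i : ι) (n : ℕ) :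
    factor m b i n * (1 - MvPowerSeries.X 1 ^ 2 * mono m b i n) = 1 - mono m b i n := by
  rw [factor, mul_assoc, MvPowerSeries.invOfUnit_mul _ _ (by simp), mul_one]

theorem dvd_factor_sub_one {m : ℕ} (hm : 0 < m) (b : P.Base) (i : ι) (n : ℕ) :
    (MvPowerSeries.X 0 : Series P) ^ n ∣ factor m b i n - 1 := by
  have hz : (MvPowerSeries.X 0 : Series P) ^ n ∣ mono m b i n := by
    classical
    rw [MvPowerSeries.X_pow_dvd_iff]
    intro d hd
    rw [mono, MvPowerSeries.coeff_monomial, if_neg]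
    rintro rfl
    rw [Finsupp.single_eq_same] at hd
    have : n + chi b i ≤ m * (n + chi b i) := Nat.le_mul_of_pos_left _ hm
    omega
  have h1 : (1 - MvPowerSeries.X 1 ^ 2 * mono m b i n) *
      MvPowerSeries.invOfUnit (1 - MvPowerSeries.X 1 ^ 2 * mono m b i n) 1 = 1 :=
    MvPowerSeries.mul_invOfUnit _ _ (by simp)
  have : factor m b i n - 1 = mono m b i n * ((MvPowerSeries.X 1 ^ 2 - 1) *
      MvPowerSeries.invOfUnit (1 - MvPowerSeries.X 1 ^ 2 * mono m b i n) 1) := by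
    rw [factor]
    linear_combination h1
  rw [this]
  exact hz.mul_right _

variable [Fintype ι]

/-- The product of the factors over all roots `α` and all `0 ≤ n < N`. -/
def partialProd (m : ℕ) (b : P.Base) (N : ℕ) : Series P :=
  ∏ i, ∏ n ∈ Finset.range N, factor m b i n

/-- The infinite product over all roots `α` and all `n ≥ 0`. The coefficient of a monomial of
degree `d 0` in `q^{1/m}` is not affected by the factors with `n > d 0`, see
`coeff_partialProd`. -/
def kernel (m : ℕ) (b : P.Base) : Series P :=
  fun d => MvPowerSeries.coeff d (partialProd m b (d 0 + 1))

/-- The partial products converge coefficientwise to `kernel`, and each coefficient is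
eventually constant. -/
theorem coeff_partialProd {m : ℕ} (hm : 0 < m) (b : P.Base) (d : Fin 2 →₀ ℕ) {N : ℕ}
    (hN : d 0 < N) :
    MvPowerSeries.coeff d (partialProd m b N) = MvPowerSeries.coeff d (kernel m b) := by
  have step : ∀ n, (MvPowerSeries.X 0 : Series P) ^ n ∣
      partialProd m b (n + 1) - partialProd m b n := by
    intro n
    have h1 : (MvPowerSeries.X 0 : Series P) ^ n ∣ (∏ i, factor m b i n) - 1 := by
      rw [← Ideal.mem_span_singleton, ← Ideal.Quotient.eq, map_prod, map_one]
      refine Finset.prod_eq_one fun i _ => ?_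
      rw [← map_one (Ideal.Quotient.mk _), Ideal.Quotient.eq, Ideal.mem_span_singleton]
      exact dvd_factor_sub_one hm b i n
    have h2 : partialProd m b (n + 1) - partialProd m b n
        = partialProd m b n * ((∏ i, factor m b i n) - 1) := by
      simp only [partialProd, Finset.prod_range_succ, Finset.prod_mul_distrib]
      ring
    rw [h2]
    exact h1.mul_left _
  change _ = MvPowerSeries.coeff d (partialProd m b (d 0 + 1))
  induction N, (Nat.succ_le_of_lt hN) using Nat.le_induction with
  | base => rfl
  | succ n hn ih =>
    have := (MvPowerSeries.X_pow_dvd_iff.mp (step n)) d (by omega)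
    rw [map_sub, sub_eq_zero] at this
    rw [this]
    exact ih (by omega)

/-- The coefficient of `e^μ` in a series, a power series in `q^{1/m}` and `t⁻¹`. -/
def expCoeff (F : Series P) (μ : weightLattice P) : MvPowerSeries (Fin 2) ℚ :=
  fun d => (MvPowerSeries.coeff d F).coeff μ

/-- The constant term `[h F]_0`, i.e. the coefficient of `e^0`, of the product of a polynomial `h`
with a series `F`. -/
def constantTerm (h : Poly P) (F : Series P) : ValueField :=
  h.coeff.sum fun μ a =>
    emb a * algebraMap (MvPowerSeries (Fin 2) ℚ) ValueField (expCoeff F (-μ))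

/-- Cherednik's scalar product `(f, g)_{q,t} = [f · ι(bar g) · C_{q,t}]_0`. -/
def pairing (m : ℕ) (b : P.Base) (f g : Poly P) : ValueField :=
  constantTerm (f * iotaPoly (bar g)) (kernel m b)

end Kernel

section Exponents

variable {P : RootPairing ι ℚ E V}

/-- The number of roots of height `n`. -/
def heightCount (b : P.Base) (n : ℕ) : ℕ := Nat.card {i : ι // b.height i = n}

/-- The exponents `d_1 ≤ … ≤ d_r` (argument `1 ≤ k ≤ r`, where `r` is the rank): they form the
partition dual to `heightCount 1 ≥ heightCount 2 ≥ …`, listed in increasing order, so that `d_k`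
is the number of `n ≥ 1` with `heightCount n ≥ r + 1 - k`. -/
def exponent (b : P.Base) (k : ℕ) : ℕ :=
  Nat.card {n : ℕ // 1 ≤ n ∧ Module.finrank ℚ E + 1 - k ≤ heightCount b n}

end Exponents

end Cherednik

end

/-! ### Integral weights, Laurent exponents and truncations of the kernel. -/

noncomputable section

namespace Cherednik

open MvPowerSeries
variable {ι E V : Type*} [AddCommGroup E] [Module ℚ E] [AddCommGroup V] [Module ℚ V]

/-! Put s = t⁻² and let c(μ) be the coefficient of e^μ in the kernel C, so that the claim compares
c(α) with c(0).

Relations. Let γ be a simple root or -θ, with θ a root of maximal height, and let z = q^{χ(γ)}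
e^{-γ}. The affine reflection S attached to γ inverts z and permutes the other monomials q^{n+χ(α)}
e^{-α}. Hence F = (1 - s z) C is an S-invariant product times 1 - z, and z · S(F) = -F.
Coefficientwise this is a linear relation between c at four weights (`kernelCoeff_relation`). As S
creates negative powers of q, the identity is proved on polynomial truncations
(`exists_polySeries_approx`).

Solution. On roots, try c(α) = A s^{-ht α} for α > 0 and B s^{-ht α} for α < 0. The simple
reflections require B s = A + (s - 1) c(0), and θ requires A = q s^{ht θ + 1} B. These two equations
determine A and B, and A gives the stated formula.

Uniqueness (`eq_heightSolution`). By induction on root length, the deviation of c from this solution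
changes only by powers of s under simple reflections, so it is known on a Weyl orbit up to one
scalar. By irreducibility the orbit contains a root k with ⟨k, θ^∨⟩ = n > 0, and the reflection in θ
contributes a factor s q^n. As q^n s^a ≠ 1, the deviation vanishes. Finally d_r = ht θ
(`IsHighest.exponent_eq`). -/

/-- The pairing of a weight with the coroot of index `j`, an integer. -/
def wtPairing (P : RootPairing ι ℚ E V) (j : ι) : weightLattice P →+ ℤ :=
  AddMonoidHom.mk' (fun x => (x.2 j).choose) fun x y => by
    have h : (((x + y).2 j).choose : ℚ) = ((x.2 j).choose + (y.2 j).choose : ℤ) := by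
      rw [← ((x + y).2 j).choose_spec, Int.cast_add, ← (x.2 j).choose_spec,
        ← (y.2 j).choose_spec, AddSubgroup.coe_add, map_add, LinearMap.add_apply]
    exact_mod_cast h

theorem wtPairing_cast (P : RootPairing ι ℚ E V) (j : ι) (x : weightLattice P) :
    (wtPairing P j x : ℚ) = P.toLinearMap x (P.coroot j) :=
  ((x.2 j).choose_spec).symm

variable {P : RootPairing ι ℚ E V}

/-- The exponents `(μ, k, l)` of the monomials `e^μ X₀^k X₁^l`. -/
abbrev Expt (P : RootPairing ι ℚ E V) : Type _ := weightLattice P × ℤ × ℕ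

/-- Polynomials in `q^{1/m}` and `t⁻¹` with coefficients in the rational group algebra. -/
abbrev PolySeries (P : RootPairing ι ℚ E V) : Type _ :=
  MvPolynomial (Fin 2) (AddMonoidAlgebra ℚ (weightLattice P))

/-- Exponents of monomials in two variables, as integral exponents. -/
def exptOf (μ : weightLattice P) (d : Fin 2 →₀ ℕ) : Expt P := (μ, (d 0 : ℤ), d 1)

theorem exptOf_injective (μ ν : weightLattice P) (d e : Fin 2 →₀ ℕ)
    (h : exptOf μ d = exptOf ν e) : μ = ν ∧ d = e := by
  simp only [exptOf, Prod.mk.injEq, Nat.cast_inj] at h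
  refine ⟨h.1, ?_⟩
  ext i
  fin_cases i
  · exact h.2.1
  · exact h.2.2

/-- The inclusion of polynomials into the ring in which affine reflections act. -/
def toLaurent : PolySeries P →+* AddMonoidAlgebra ℚ (Expt P) :=
  MvPolynomial.eval₂Hom
    (AddMonoidAlgebra.mapDomainRingHom ℚ (AddMonoidHom.inl (weightLattice P) (ℤ × ℕ)))
    (fun i => AddMonoidAlgebra.single (exptOf 0 (Finsupp.single i 1)) 1)

theorem toLaurent_monomial (d : Fin 2 →₀ ℕ) (μ : weightLattice P) (c : ℚ) :
    toLaurent (MvPolynomial.monomial d (AddMonoidAlgebra.single μ c)) =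
      AddMonoidAlgebra.single (exptOf μ d) c := by
  rw [toLaurent, MvPolynomial.coe_eval₂Hom, MvPolynomial.eval₂_monomial, Finsupp.prod_fintype _ _
    (by simp), Fin.prod_univ_two, AddMonoidAlgebra.single_pow, AddMonoidAlgebra.single_pow,
    AddMonoidAlgebra.single_mul_single]
  simp [exptOf, AddMonoidAlgebra.single_mul_single]

theorem polySeries_induction {p : PolySeries P → Prop}
    (monomial : ∀ d μ c, p (MvPolynomial.monomial d (AddMonoidAlgebra.single μ c)))
    (add : ∀ F G, p F → p G → p (F + G)) (F : PolySeries P) : p F := by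
  induction F using MvPolynomial.induction_on' with
  | monomial d a =>
    induction a using AddMonoidAlgebra.induction_linear with
    | zero => simpa using monomial d 0 0
    | add f g hf hg => rw [map_add]; exact add _ _ hf hg
    | single μ c => exact monomial d μ c
  | add F G hF hG => exact add F G hF hG

theorem coeff_toLaurent_exptOf (F : PolySeries P) (μ : weightLattice P) (d : Fin 2 →₀ ℕ) :
    (toLaurent F).coeff (exptOf μ d) = (MvPolynomial.coeff d F).coeff μ := by
  classical
  induction F using polySeries_induction with
  | monomial e ν c =>
    rw [toLaurent_monomial, MvPolynomial.coeff_monomial, AddMonoidAlgebra.coeff_single, Finsupp.single_apply]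
    by_cases h : exptOf ν e = exptOf μ d
    · obtain ⟨rfl, rfl⟩ := exptOf_injective _ _ _ _ h
      simp
    · rw [if_neg h]
      split_ifs with he
      · rw [AddMonoidAlgebra.coeff_single, Finsupp.single_apply, if_neg]
        rintro rfl
        exact h (by rw [he])
      · simp
  | add F G hF hG => simp [hF, hG]

/-- Needed where a reflection moves an exponent of q below zero. -/
theorem coeff_toLaurent_of_neg (F : PolySeries P) (v : Expt P) (hv : v.2.1 < 0) :
    (toLaurent F).coeff v = 0 := by
  classical
  induction F using polySeries_induction with
  | monomial e ν c =>
    rw [toLaurent_monomial, AddMonoidAlgebra.coeff_single, Finsupp.single_apply, if_neg]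
    rintro rfl
    simp only [exptOf] at hv
    omega
  | add F G hF hG => simp [hF, hG]

/-- The truncation `(1 - z) (1 + w z + … + (w z)^(M-1))` of `(1 - z) / (1 - w z)`. -/
def truncFactor {A : Type*} [CommRing A] (w : A) (M : ℕ) (z : A) : A :=
  (1 - z) * ∑ k ∈ Finset.range M, (w * z) ^ k

theorem map_truncFactor {A B : Type*} [CommRing A] [CommRing B] (f : A →+* B) (w : A) (M : ℕ)
    (z : A) : f (truncFactor w M z) = truncFactor (f w) M (f z) := by
  simp [truncFactor]

theorem truncFactor_mul {A : Type*} [CommRing A] (w : A) (M : ℕ) (z : A) :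
    (1 - w * z) * truncFactor w M z = (1 - z) * (1 - (w * z) ^ M) := by
  rw [truncFactor, ← mul_neg_geom_sum]
  ring

/-- The power series that vanish up to degree `N` in `q^{1/m}` and up to degree `M` in `t⁻¹`. -/
def truncIdeal (P : RootPairing ι ℚ E V) (N M : ℕ) : Ideal (Series P) :=
  Ideal.span {(X 0) ^ N, (X 1) ^ M}

theorem coeff_eq_of_mk_eq {N M : ℕ} {F G : Series P}
    (h : Ideal.Quotient.mk (truncIdeal P N M) F = Ideal.Quotient.mk (truncIdeal P N M) G)
    {d : Fin 2 →₀ ℕ} (h0 : d 0 < N) (h1 : d 1 < M) : coeff d F = coeff d G := by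
  rw [Ideal.Quotient.eq, truncIdeal, Ideal.mem_span_pair] at h
  obtain ⟨a, c, h⟩ := h
  rw [← sub_eq_zero, ← map_sub, ← h, map_add,
    X_pow_dvd_iff.mp (Dvd.intro_left a rfl) d h0, X_pow_dvd_iff.mp (Dvd.intro_left c rfl) d h1,
    add_zero]

theorem mk_eq_of_X_zero_pow_dvd {N M : ℕ} {F G : Series P} (h : (X 0 : Series P) ^ N ∣ F - G) :
    Ideal.Quotient.mk (truncIdeal P N M) F = Ideal.Quotient.mk (truncIdeal P N M) G := by
  rw [Ideal.Quotient.eq]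
  exact Ideal.mem_of_dvd _ h (Ideal.subset_span (by simp))

theorem mk_eq_of_X_one_pow_dvd {N M : ℕ} {F G : Series P} (h : (X 1 : Series P) ^ M ∣ F - G) :
    Ideal.Quotient.mk (truncIdeal P N M) F = Ideal.Quotient.mk (truncIdeal P N M) G := by
  rw [Ideal.Quotient.eq]
  exact Ideal.mem_of_dvd _ h (Ideal.subset_span (by simp))

variable [P.IsCrystallographic]

theorem wtPairing_rootWeight (i j : ι) :
    wtPairing P j (rootWeight P i) = P.pairingIn ℤ i j := by
  have h : (wtPairing P j (rootWeight P i) : ℚ) = (P.pairingIn ℤ i j : ℤ) := by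
    rw [wtPairing_cast]
    exact (P.algebraMap_pairingIn ℤ i j).symm
  exact_mod_cast h

theorem rootWeight_reflectionPerm (i j : ι) :
    rootWeight P (P.reflectionPerm j i) =
      rootWeight P i - P.pairingIn ℤ i j • rootWeight P j := by
  apply Subtype.ext
  change P.root _ = P.root i - ((P.pairingIn ℤ i j • rootWeight P j : weightLattice P) : E)
  rw [AddSubgroup.coe_zsmul, RootPairing.root_reflectionPerm, P.reflection_apply_root' ℤ]
  rfl

/-- The affine reflection `(μ, k, l) ↦ (μ - ⟨μ, γ^∨⟩ γ, k + a ⟨μ, γ^∨⟩, l)`. -/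
def affineReflection (a : ℤ) (γ : ι) : Expt P →+ Expt P where
  toFun v := (v.1 - wtPairing P γ v.1 • rootWeight P γ, v.2.1 + a * wtPairing P γ v.1, v.2.2)
  map_zero' := by simp
  map_add' v w := by
    ext1
    · simp only [Prod.fst_add, map_add, add_smul]; abel
    · ext1
      · simp only [Prod.fst_add, Prod.snd_add, map_add]; ring
      · rfl

theorem affineReflection_apply (a : ℤ) (γ : ι) (v : Expt P) :
    affineReflection a γ v = (v.1 - wtPairing P γ v.1 • rootWeight P γ,
      v.2.1 + a * wtPairing P γ v.1, v.2.2) := rfl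

theorem affineReflection_involutive (a : ℤ) (γ : ι) :
    Function.Involutive (affineReflection a γ : Expt P → Expt P) := by
  intro v
  have h : wtPairing P γ (v.1 - wtPairing P γ v.1 • rootWeight P γ) = - wtPairing P γ v.1 := by
    rw [map_sub, map_zsmul, wtPairing_rootWeight, RootPairing.pairingIn_same]
    simp; ring
  simp only [affineReflection_apply, h]
  ext1
  · simp
  · simp

/-- The monomial `q^{n + χ(α)} e^{-α}`, as a polynomial. -/
def monoPoly (m : ℕ) (b : P.Base) (x : ι × ℕ) : PolySeries P :=
  MvPolynomial.monomial (Finsupp.single 0 (m * (x.2 + chi b x.1)))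
    (AddMonoidAlgebra.single (-rootWeight P x.1) 1)

theorem coe_monoPoly (m : ℕ) (b : P.Base) (x : ι × ℕ) :
    MvPolynomial.coeToMvPowerSeries.ringHom (monoPoly m b x) = mono m b x.1 x.2 := by
  simp [monoPoly, mono, MvPolynomial.coe_monomial]

theorem mk_truncFactor (m : ℕ) (b : P.Base) (i : ι) (n N M : ℕ) :
    Ideal.Quotient.mk (truncIdeal P N M) (truncFactor (X 1 ^ 2) M (mono m b i n)) =
      Ideal.Quotient.mk (truncIdeal P N M) (factor m b i n) := by
  have h1 : (1 - X 1 ^ 2 * mono m b i n) *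
      invOfUnit (1 - X 1 ^ 2 * mono m b i n) 1 = 1 := mul_invOfUnit _ _ (by simp)
  have h2 := truncFactor_mul (X 1 ^ 2) M (mono m b i n)
  apply mk_eq_of_X_one_pow_dvd
  refine ⟨-(X 1 ^ M * mono m b i n ^ M * (1 - mono m b i n) *
    invOfUnit (1 - X 1 ^ 2 * mono m b i n) 1), ?_⟩
  rw [factor]
  linear_combination (-truncFactor (X 1 ^ 2) M (mono m b i n)) * h1 +
    (invOfUnit (1 - X 1 ^ 2 * mono m b i n) 1) * h2

variable [Fintype ι]

/-- Factors with n ≥ N are 1 modulo q^{N/m}. This freedom in `T` allows an index set stable under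
the affine reflection, which the box itself need not be. -/
theorem mk_prod_truncFactor {m : ℕ} (hm : 0 < m) (b : P.Base) (N M : ℕ) (T : Finset (ι × ℕ))
    (hT : Finset.univ ×ˢ Finset.range N ⊆ T) :
    Ideal.Quotient.mk (truncIdeal P N M)
        (∏ x ∈ T, truncFactor (X 1 ^ 2) M (mono m b x.1 x.2)) =
      Ideal.Quotient.mk (truncIdeal P N M) (partialProd m b N) := by
  rw [partialProd, ← Finset.prod_product', map_prod, map_prod]
  simp only [mk_truncFactor]
  refine (Finset.prod_subset hT fun x _ hx => ?_).symm
  rw [← map_one (Ideal.Quotient.mk (truncIdeal P N M))]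
  apply mk_eq_of_X_zero_pow_dvd
  simp only [Finset.mem_product, Finset.mem_univ, Finset.mem_range, true_and, not_lt] at hx
  exact (pow_dvd_pow _ hx).trans (dvd_factor_sub_one hm b x.1 x.2)

theorem mk_kernel {m : ℕ} (hm : 0 < m) (b : P.Base) (N M : ℕ) :
    Ideal.Quotient.mk (truncIdeal P N M) (kernel m b) =
      Ideal.Quotient.mk (truncIdeal P N M) (partialProd m b N) := by
  apply mk_eq_of_X_zero_pow_dvd
  rw [X_pow_dvd_iff]
  intro d hd
  rw [map_sub, coeff_partialProd hm b d hd, sub_self]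

end Cherednik

end

/-! ### Affine reflections permute the factors of the kernel. -/

noncomputable section

namespace Cherednik

open MvPowerSeries
variable {ι E V : Type*} [AddCommGroup E] [Module ℚ E] [AddCommGroup V] [Module ℚ V]
variable {P : RootPairing ι ℚ E V}

theorem chi_reflectionPerm_self (b : P.Base) (γ : ι) :
    chi b (P.reflectionPerm γ γ) + chi b γ = 1 := by
  have h := RootPairing.Base.IsPos.neg_iff_not b γ
  change b.IsPos (P.reflectionPerm γ γ) ↔ _ at h
  by_cases h' : b.IsPos γ <;> simp [chi, h, h']

variable [P.IsCrystallographic]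

/-- The condition that the affine reflection attached to the monomial `q^{χ(γ)} e^{-γ}` permutes
the monomials `q^{n + χ(α)} e^{-α}` different from it. -/
def IsAffineSimple (b : P.Base) (γ : ι) : Prop :=
  ∀ α ≠ γ, (chi b (P.reflectionPerm γ α) : ℤ) + chi b γ * P.pairingIn ℤ α γ ≤ chi b α

/-- The permutation of the monomials `q^{n + χ(α)} e^{-α}` induced by an affine reflection. -/
def affineShift (b : P.Base) (γ : ι) (x : ι × ℕ) : ι × ℕ :=
  (P.reflectionPerm γ x.1, ((x.2 : ℤ) + chi b x.1 - chi b γ * P.pairingIn ℤ x.1 γ -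
    chi b (P.reflectionPerm γ x.1)).toNat)

variable {b : P.Base} {γ : ι}

/-- Away from (γ, 0) the `toNat` in `affineShift` truncates nothing. For α = γ this needs n ≥ 1,
because χ(γ) + χ(-γ) = 1. -/
theorem affineShift_snd (hγ : IsAffineSimple b γ) {x : ι × ℕ} (hx : x ≠ (γ, 0)) :
    ((affineShift b γ x).2 : ℤ) + chi b (affineShift b γ x).1 =
      x.2 + chi b x.1 - chi b γ * P.pairingIn ℤ x.1 γ := by
  obtain ⟨α, n⟩ := x
  simp only [affineShift]
  rw [Int.toNat_of_nonneg]
  · ring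
  · by_cases h : α = γ
    · subst h
      have h1 : n ≠ 0 := fun h => hx (by rw [h])
      have h2 := chi_reflectionPerm_self b α
      rw [RootPairing.pairingIn_same]
      omega
    · have := hγ α h
      linarith [Int.natCast_nonneg n]

theorem affineShift_affineShift (hγ : IsAffineSimple b γ) {x : ι × ℕ} (hx : x ≠ (γ, 0)) :
    affineShift b γ (affineShift b γ x) = x := by
  have h := affineShift_snd hγ hx
  obtain ⟨α, n⟩ := x
  rw [affineShift, h]
  have h' : P.pairingIn ℤ (P.reflectionPerm γ α) γ = -P.pairingIn ℤ α γ := by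
    rw [← RootPairing.pairingIn_reflectionPerm, RootPairing.pairingIn_reflectionPerm_self_right]
  simp [affineShift, h']

theorem affineShift_ne (hγ : IsAffineSimple b γ) {x : ι × ℕ} (hx : x ≠ (γ, 0)) :
    affineShift b γ x ≠ (γ, 0) := by
  intro h
  have h1 := affineShift_affineShift hγ hx
  have h2 := affineShift_snd hγ hx
  rw [h] at h1 h2
  rw [← h1] at h2
  have h3 := chi_reflectionPerm_self b γ
  -- At (γ, 0) itself `toNat` truncates -1 to 0, so x would be (-γ, 0), whose true image has
  -- exponent χ(γ) + 1 instead of χ(γ).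
  simp only [affineShift, RootPairing.pairingIn_reflectionPerm_self_left,
    RootPairing.pairingIn_same] at h2
  omega

theorem toLaurent_monoPoly (m : ℕ) (b : P.Base) (x : ι × ℕ) :
    toLaurent (monoPoly m b x) =
      AddMonoidAlgebra.single (-rootWeight P x.1, ((m * (x.2 + chi b x.1) : ℕ) : ℤ), 0) 1 := by
  rw [monoPoly, toLaurent_monomial]
  simp [exptOf]

theorem reflect_monoPoly (m : ℕ) (hγ : IsAffineSimple b γ) {x : ι × ℕ} (hx : x ≠ (γ, 0)) :
    AddMonoidAlgebra.mapDomainRingHom ℚ (affineReflection (m * chi b γ : ℤ) γ)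
        (toLaurent (monoPoly m b x)) = toLaurent (monoPoly m b (affineShift b γ x)) := by
  have h := affineShift_snd hγ hx
  rw [toLaurent_monoPoly, toLaurent_monoPoly, AddMonoidAlgebra.mapDomainRingHom_apply,
    AddMonoidAlgebra.mapDomain_single, affineReflection_apply]
  congr 2
  · simp only [map_neg, wtPairing_rootWeight, affineShift, rootWeight_reflectionPerm]
    module
  · ext1
    · simp only [map_neg, wtPairing_rootWeight]
      push_cast
      rw [h]
      ring
    · rfl

theorem reflect_truncFactor (m M : ℕ) (hγ : IsAffineSimple b γ) {x : ι × ℕ} (hx : x ≠ (γ, 0)) :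
    AddMonoidAlgebra.mapDomainRingHom ℚ (affineReflection (m * chi b γ : ℤ) γ)
        (toLaurent (truncFactor (MvPolynomial.X 1 ^ 2) M (monoPoly m b x))) =
      toLaurent (truncFactor (MvPolynomial.X 1 ^ 2) M (monoPoly m b (affineShift b γ x))) := by
  have h : AddMonoidAlgebra.mapDomainRingHom ℚ (affineReflection (m * chi b γ : ℤ) γ)
      (toLaurent (MvPolynomial.X 1)) = toLaurent (MvPolynomial.X 1 : PolySeries P) := by
    rw [MvPolynomial.X, AddMonoidAlgebra.one_def, toLaurent_monomial,
      AddMonoidAlgebra.mapDomainRingHom_apply, AddMonoidAlgebra.mapDomain_single,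
      affineReflection_apply]
    simp [exptOf]
  simp only [map_truncFactor, reflect_monoPoly m hγ hx, map_pow, h]

variable [Fintype ι]

/-- The reflection does not act on power series, since it lowers exponents of q without bound.
Truncating each geometric series and using a finite reflection-stable set of factors gives a
polynomial whose antisymmetry is exact, while it agrees with the series in low degrees. -/
theorem exists_polySeries_approx {m : ℕ} (hm : 0 < m) (hγ : IsAffineSimple b γ) (K : ℕ) :
    ∃ G : PolySeries P,
      (∀ d : Fin 2 →₀ ℕ, d 0 < K → d 1 < K →
        coeff d ((1 - X 1 ^ 2 * mono m b γ 0) * kernel m b) = MvPolynomial.coeff d G) ∧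
      ∀ v : Expt P, (toLaurent G).coeff v =
        -(toLaurent G).coeff ((-rootWeight P γ, ((m * chi b γ : ℕ) : ℤ), 0) +
          affineReflection (m * chi b γ : ℤ) γ v) := by
  classical
  let F : Finset (ι × ℕ) := (Finset.univ ×ˢ Finset.range K).erase (γ, 0)
  -- Since the shift is an involution off (γ, 0), adding the image makes the index set stable.
  let T : Finset (ι × ℕ) := F ∪ F.image (affineShift b γ)
  have hT : ∀ x ∈ T, x ≠ (γ, 0) := by
    intro x hx
    rcases Finset.mem_union.mp hx with hx | hx
    · exact Finset.ne_of_mem_erase hx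
    · obtain ⟨y, hy, rfl⟩ := Finset.mem_image.mp hx
      exact affineShift_ne hγ (Finset.ne_of_mem_erase hy)
  have hτ : ∀ x ∈ T, affineShift b γ x ∈ T := by
    intro x hx
    rcases Finset.mem_union.mp hx with hx | hx
    · exact Finset.mem_union_right _ (Finset.mem_image_of_mem _ hx)
    · obtain ⟨y, hy, rfl⟩ := Finset.mem_image.mp hx
      rw [affineShift_affineShift hγ (Finset.ne_of_mem_erase hy)]
      exact Finset.mem_union_left _ hy
  let φ : ι × ℕ → PolySeries P := fun x => truncFactor (MvPolynomial.X 1 ^ 2) K (monoPoly m b x)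
  let D : PolySeries P := ∏ x ∈ T, φ x
  let S : AddMonoidAlgebra ℚ (Expt P) →+* AddMonoidAlgebra ℚ (Expt P) :=
    AddMonoidAlgebra.mapDomainRingHom ℚ (affineReflection (m * chi b γ : ℤ) γ)
  have hD : S (toLaurent D) = toLaurent D := by
    simp only [D, map_prod]
    refine Finset.prod_bij' (fun x _ => affineShift b γ x) (fun x _ => affineShift b γ x) hτ hτ
      (fun x hx => affineShift_affineShift hγ (hT x hx))
      (fun x hx => affineShift_affineShift hγ (hT x hx)) fun x hx => ?_
    exact reflect_truncFactor m K hγ (hT x hx)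
  refine ⟨D * (1 - monoPoly m b (γ, 0)), fun d h0 h1 => ?_, fun v => ?_⟩
  · rw [← MvPolynomial.coeff_coe]
    refine coeff_eq_of_mk_eq (N := K) (M := K) ?_ h0 h1
    have hmem : (γ, 0) ∉ T := fun h => hT _ h rfl
    have hsub : Finset.univ ×ˢ Finset.range K ⊆ insert (γ, 0) T := by
      intro x hx
      rw [Finset.mem_insert]
      by_cases h : x = (γ, 0)
      · exact Or.inl h
      · exact Or.inr (Finset.mem_union_left _ (Finset.mem_erase.mpr ⟨h, hx⟩))
    rw [map_mul, mk_kernel hm, ← mk_prod_truncFactor hm b K K _ hsub, ← map_mul,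
      Finset.prod_insert hmem]
    have hcoe : ((D * (1 - monoPoly m b (γ, 0)) : PolySeries P) : Series P) =
        (∏ x ∈ T, truncFactor (X 1 ^ 2) K (mono m b x.1 x.2)) * (1 - mono m b γ 0) := by
      change MvPolynomial.coeToMvPowerSeries.ringHom _ = _
      simp only [D, φ, map_mul, map_prod, map_sub, map_one, map_truncFactor, coe_monoPoly, map_pow]
      simp
    rw [hcoe]
    apply mk_eq_of_X_one_pow_dvd
    have h2 := truncFactor_mul (X 1 ^ 2) K (mono m b γ 0)
    refine ⟨-((∏ x ∈ T, truncFactor (X 1 ^ 2) K (mono m b x.1 x.2)) * (1 - mono m b γ 0) *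
      (X 1 ^ K * mono m b γ 0 ^ K)), ?_⟩
    linear_combination (∏ x ∈ T, truncFactor (X 1 ^ 2) K (mono m b x.1 x.2)) * h2
  · set G := D * (1 - monoPoly m b (γ, 0)) with hG
    -- With z the monomial of (γ, 0): `D` is invariant and z · S(1 - z) = z - 1, because z · S(z) =
    -- 1.
    have hS : AddMonoidAlgebra.single (-rootWeight P γ, ((m * chi b γ : ℕ) : ℤ), 0) 1 *
        S (toLaurent G) = -toLaurent G := by
      rw [hG, map_mul, map_mul, hD, map_sub, map_sub, map_one, map_one, toLaurent_monoPoly,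
        AddMonoidAlgebra.mapDomainRingHom_apply, AddMonoidAlgebra.mapDomain_single,
        affineReflection_apply]
      have : (AddMonoidAlgebra.single (-rootWeight P γ, ((m * chi b γ : ℕ) : ℤ), 0) 1 :
            AddMonoidAlgebra ℚ (Expt P)) *
          AddMonoidAlgebra.single (-rootWeight P γ -
              wtPairing P γ (-rootWeight P γ) • rootWeight P γ,
            ((m * (0 + chi b γ) : ℕ) : ℤ) + m * chi b γ * wtPairing P γ (-rootWeight P γ), 0) 1
          = 1 := by
        rw [AddMonoidAlgebra.single_mul_single, AddMonoidAlgebra.one_def, map_neg,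
          wtPairing_rootWeight, RootPairing.pairingIn_same]
        congr 1
        · ext1
          · simp only [Prod.fst_add, Prod.fst_zero]
            module
          · ext1
            · simp only [Prod.fst_add, Prod.snd_add, Prod.snd_zero, Prod.fst_zero]
              push_cast
              ring
            · rfl
        · simp
      simp only [zero_add] at this ⊢
      linear_combination (-toLaurent D) * this
    have h1 : (toLaurent G).coeff v =
        (S (toLaurent G)).coeff (affineReflection (m * chi b γ : ℤ) γ v) :=
      (Finsupp.mapDomain_apply (affineReflection_involutive _ γ).injective _ _).symm
    have h2 := congrArg (fun f => f.coeff ((-rootWeight P γ, ((m * chi b γ : ℕ) : ℤ), 0) +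
      affineReflection (m * chi b γ : ℤ) γ v)) hS
    simp only [AddMonoidAlgebra.coeff_neg, Finsupp.neg_apply] at h2
    rw [h1, ← h2, AddMonoidAlgebra.coeff_single_mul_eq_mul_coeff
      (affineReflection (m * chi b γ : ℤ) γ v), one_mul]
    intro w _
    exact add_right_inj _

end Cherednik

end

/-! ### Antisymmetry read off on coefficients of e^μ. -/

noncomputable section

namespace Cherednik

open MvPowerSeries
variable {ι E V : Type*} [AddCommGroup E] [Module ℚ E] [AddCommGroup V] [Module ℚ V]
variable {P : RootPairing ι ℚ E V}

theorem coeff_expCoeff (F : Series P) (μ : weightLattice P) (d : Fin 2 →₀ ℕ) :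
    coeff d (expCoeff F μ) = (coeff d F).coeff μ := rfl

theorem expCoeff_sub (F G : Series P) (μ : weightLattice P) :
    expCoeff (F - G) μ = expCoeff F μ - expCoeff G μ := by
  ext d
  simp [coeff_expCoeff]

theorem expCoeff_monomial_mul (e : Fin 2 →₀ ℕ) (ν μ : weightLattice P) (F : Series P) :
    expCoeff (monomial e (AddMonoidAlgebra.single ν 1) * F) μ =
      monomial e 1 * expCoeff F (μ - ν) := by
  classical
  ext d
  rw [coeff_expCoeff, coeff_monomial_mul, coeff_monomial_mul]
  split_ifs with h
  · rw [coeff_expCoeff, AddMonoidAlgebra.coeff_single_mul_eq_mul_coeff (μ - ν)]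
    intro w _
    rw [eq_sub_iff_add_eq, add_comm]
  · rfl

variable [P.IsCrystallographic] {b : P.Base} {γ : ι}

theorem expCoeff_one_sub_mono_mul (m : ℕ) (F : Series P) (μ : weightLattice P) :
    expCoeff ((1 - X 1 ^ 2 * mono m b γ 0) * F) μ =
      expCoeff F μ - X 1 ^ 2 * X 0 ^ (m * chi b γ) * expCoeff F (μ + rootWeight P γ) := by
  have h : (X 1 ^ 2 * mono m b γ 0 : Series P) =
      monomial (Finsupp.single 1 2 + Finsupp.single 0 (m * chi b γ))
        (AddMonoidAlgebra.single (-rootWeight P γ) 1) := by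
    rw [X_pow_eq, mono, monomial_mul_monomial, one_mul, zero_add]
  rw [sub_mul, one_mul, expCoeff_sub, h, expCoeff_monomial_mul, X_pow_eq, X_pow_eq,
    monomial_mul_monomial, one_mul, sub_neg_eq_add]

variable [Fintype ι]

/-- The exponent `e` is the shift in powers of q^{1/m} caused by the reflection. Taking it in ℕ
keeps the relation inside power series. -/
theorem X_zero_pow_mul_expCoeff {m : ℕ} (hm : 0 < m) (hγ : IsAffineSimple b γ)
    (μ : weightLattice P) (e : ℕ) (he : (e : ℤ) = m * chi b γ * (wtPairing P γ μ + 1)) :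
    X 0 ^ e * expCoeff ((1 - X 1 ^ 2 * mono m b γ 0) * kernel m b) μ =
      -expCoeff ((1 - X 1 ^ 2 * mono m b γ 0) * kernel m b)
        (μ - (wtPairing P γ μ + 1) • rootWeight P γ) := by
  classical
  ext d
  obtain ⟨G, hG, hS⟩ := exists_polySeries_approx hm hγ (d 0 + d 1 + 1)
  -- This exponent is the one that the reflection and the shift by z carry to the monomial `d` on
  -- the right-hand side.
  have h := hS (μ, (d 0 : ℤ) - e, d 1)
  have h1 : ((-rootWeight P γ, ((m * chi b γ : ℕ) : ℤ), 0) +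
      affineReflection (m * chi b γ : ℤ) γ (μ, (d 0 : ℤ) - e, d 1) : Expt P) =
      exptOf (μ - (wtPairing P γ μ + 1) • rootWeight P γ) d := by
    rw [affineReflection_apply, exptOf, he]
    ext1
    · simp only [Prod.fst_add]
      module
    · ext1
      · simp only [Prod.fst_add, Prod.snd_add]
        push_cast
        ring
      · simp
  rw [h1, coeff_toLaurent_exptOf, ← hG d (by omega) (by omega)] at h
  rw [map_neg, coeff_expCoeff, ← h, X_pow_eq, coeff_monomial_mul]
  split_ifs with hd
  · rw [Finsupp.single_le_iff] at hd
    have h0 : (d - Finsupp.single 0 e : Fin 2 →₀ ℕ) 0 = d 0 - e := by simp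
    have h1 : (d - Finsupp.single 0 e : Fin 2 →₀ ℕ) 1 = d 1 := by simp
    have h2 : exptOf μ (d - Finsupp.single 0 e) = (μ, (d 0 : ℤ) - e, d 1) := by
      rw [exptOf, h0, h1, Nat.cast_sub hd]
    rw [one_mul, coeff_expCoeff, hG _ (by omega) (by omega), ← coeff_toLaurent_exptOf, h2]
  · rw [Finsupp.single_le_iff] at hd
    rw [coeff_toLaurent_of_neg]
    simp only
    omega

end Cherednik

end

/-! ### The highest root, affine simple roots and the relations they give. -/

noncomputable section

namespace Cherednik

open MvPowerSeries
variable {ι E V : Type*} [AddCommGroup E] [Module ℚ E] [AddCommGroup V] [Module ℚ V]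
variable {P : RootPairing ι ℚ E V}

/-- The root of index `θ` has maximal height. -/
def IsHighest (b : P.Base) (θ : ι) : Prop := ∀ i, b.height i ≤ b.height θ

variable {b : P.Base} {θ : ι}

theorem height_neg (i : ι) : b.height (P.reflectionPerm i i) = -b.height i :=
  b.height_reflectionPerm_self i

theorem IsHighest.isPos (hθ : IsHighest b θ) : b.IsPos θ := by
  have h1 := hθ (P.reflectionPerm θ θ)
  rw [height_neg] at h1
  rw [RootPairing.Base.isPos_iff']
  omega

theorem IsHighest.neg_height_le (hθ : IsHighest b θ) (i : ι) : -b.height θ ≤ b.height i := by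
  have h1 := hθ (P.reflectionPerm i i)
  rw [height_neg] at h1
  omega

theorem exists_isHighest [Finite ι] [Nonempty ι] (b : P.Base) : ∃ θ, IsHighest b θ :=
  Finite.exists_max b.height

theorem chi_of_isPos {i : ι} (h : b.IsPos i) : chi b i = 0 := if_pos h

theorem chi_le_one (i : ι) : chi b i ≤ 1 := by
  rw [chi]
  split_ifs <;> simp

theorem chi_of_not_isPos {i : ι} (h : ¬ b.IsPos i) : chi b i = 1 := if_neg h

variable [P.IsCrystallographic]

theorem height_reflectionPerm (i j : ι) :
    b.height (P.reflectionPerm j i) = b.height i - P.pairingIn ℤ i j * b.height j := by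
  have h : P.root (P.reflectionPerm j i) = P.root i + (-P.pairingIn ℤ i j) • P.root j := by
    rw [RootPairing.root_reflectionPerm, P.reflection_apply_root' ℤ, neg_smul, sub_eq_add_neg]
  rw [b.height_add_zsmul h, smul_eq_mul]
  ring

section Finite

variable [Finite ι]

/-- Otherwise α + θ would be a root of greater height. -/
theorem IsHighest.pairingIn_nonneg (hθ : IsHighest b θ) {α : ι} (hα : b.IsPos α) :
    0 ≤ P.pairingIn ℤ α θ := by
  by_contra! h
  have hpos := hθ.isPos
  rw [RootPairing.Base.isPos_iff] at hα hpos
  have hne : P.root α ≠ -P.root θ := by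
    intro h'
    have : α = P.reflectionPerm θ θ := P.root.injective (by simpa using h')
    rw [this, height_neg] at hα
    omega
  obtain ⟨k, hk⟩ := P.root_add_root_mem_of_pairingIn_neg h hne
  have h1 := b.height_add hk
  have h2 := hθ k
  omega

/-- If the pairing were at least 2, the bound ht(s_θ α) ≥ -ht θ would force ht α = ht θ, and the
root α - θ would have height 0. -/
theorem IsHighest.pairingIn_le_one (hθ : IsHighest b θ) {α : ι} (hα : α ≠ θ) :
    P.pairingIn ℤ α θ ≤ 1 := by
  by_contra! h
  have hpos := hθ.isPos
  rw [RootPairing.Base.isPos_iff] at hpos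
  have h1 := hθ.neg_height_le (P.reflectionPerm θ α)
  rw [height_reflectionPerm] at h1
  have h2 := hθ α
  obtain ⟨k, hk⟩ := P.root_sub_root_mem_of_pairingIn_pos (by omega) hα
  have h3 := b.height_sub hk
  have h4 := b.height_ne_zero k
  apply h4
  rw [h3]
  nlinarith

theorem isAffineSimple_of_mem_support [P.IsReduced] {γ : ι} (hγ : γ ∈ b.support) :
    IsAffineSimple b γ := by
  intro α hα
  rw [chi_of_isPos (RootPairing.Base.isPos_of_mem_support hγ)]
  by_cases h : b.IsPos α
  · rw [chi_of_isPos (h.reflectionPerm hγ hα)]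
    simp
  · rw [chi_of_not_isPos h]
    have := chi_le_one (b := b) (P.reflectionPerm γ α)
    push_cast
    omega

/-- A positive α pairs nonnegatively with θ^∨ and is fixed when the pairing is 0. A negative α ≠ -θ
pairs to 0 or -1, and in the latter case s_θ α = α + θ is positive. -/
theorem IsHighest.isAffineSimple_neg (hθ : IsHighest b θ) :
    IsAffineSimple b (P.reflectionPerm θ θ) := by
  intro α hα
  have hχ : chi b (P.reflectionPerm θ θ) = 1 := by
    have := chi_reflectionPerm_self b θ
    rw [chi_of_isPos hθ.isPos] at this
    omega
  have hrefl : P.reflectionPerm (P.reflectionPerm θ θ) α = P.reflectionPerm θ α :=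
    P.root.injective (by simp [RootPairing.reflection_reflectionPerm])
  rw [hχ, hrefl, RootPairing.pairingIn_reflectionPerm_self_right]
  have h1 := chi_le_one (b := b) (P.reflectionPerm θ α)
  by_cases h : b.IsPos α
  · have h2 := hθ.pairingIn_nonneg h
    rw [chi_of_isPos h]
    rcases h2.eq_or_lt with h2 | h2
    · have h3 : P.reflectionPerm θ α = α := by
        refine P.reflectionPerm_eq_of_pairing_eq_zero ?_
        rw [← P.algebraMap_pairingIn ℤ, ← h2, map_zero]
      rw [h3, ← h2, chi_of_isPos h]
      simp
    · push_cast
      omega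
  · rw [chi_of_not_isPos h]
    have hneg : b.IsPos (P.reflectionPerm α α) := by
      rw [RootPairing.Base.isPos_iff'] at h ⊢
      rw [height_neg]
      omega
    have h2 := hθ.pairingIn_nonneg hneg
    have h3 : P.pairingIn ℤ (P.reflectionPerm α α) θ ≤ 1 := by
      refine hθ.pairingIn_le_one ?_
      intro h3
      exact hα (P.root.injective (by simp [← h3, RootPairing.reflection_reflectionPerm]))
    rw [RootPairing.pairingIn_reflectionPerm_self_left] at h2 h3
    rcases h2.eq_or_lt with h2 | h2
    · push_cast
      omega
    · have h4 : b.IsPos (P.reflectionPerm θ α) := by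
        rw [RootPairing.Base.isPos_iff', height_reflectionPerm,
          show P.pairingIn ℤ α θ = -1 by omega]
        have := hθ.neg_height_le α
        omega
      rw [chi_of_isPos h4]
      push_cast
      omega

end Finite

/-- The element `q^{1/m}` (index `0`) or `t⁻¹` (index `1`) of the value field. -/
def valueGen (i : Fin 2) : ValueField :=
  algebraMap (MvPowerSeries (Fin 2) ℚ) ValueField (X i)

variable [Fintype ι]

/-- The coefficient of `e^μ` in the kernel, as an element of the value field. -/
def kernelCoeff (m : ℕ) (b : P.Base) (μ : weightLattice P) : ValueField :=
  algebraMap (MvPowerSeries (Fin 2) ℚ) ValueField (expCoeff (kernel m b) μ)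

theorem kernelCoeff_relation {m : ℕ} (hm : 0 < m) {γ : ι} (hγ : IsAffineSimple b γ)
    (μ : weightLattice P) (e : ℕ) (he : (e : ℤ) = m * chi b γ * (wtPairing P γ μ + 1)) :
    valueGen 0 ^ e * (kernelCoeff m b μ -
        valueGen 1 ^ 2 * valueGen 0 ^ (m * chi b γ) * kernelCoeff m b (μ + rootWeight P γ)) =
      -(kernelCoeff m b (μ - (wtPairing P γ μ + 1) • rootWeight P γ) -
        valueGen 1 ^ 2 * valueGen 0 ^ (m * chi b γ) *
          kernelCoeff m b (μ - wtPairing P γ μ • rootWeight P γ)) := by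
  have h := X_zero_pow_mul_expCoeff hm hγ μ e he
  rw [expCoeff_one_sub_mono_mul, expCoeff_one_sub_mono_mul,
    show μ - (wtPairing P γ μ + 1) • rootWeight P γ + rootWeight P γ =
      μ - wtPairing P γ μ • rootWeight P γ by module] at h
  simpa only [kernelCoeff, valueGen, map_mul, map_sub, map_pow, map_neg] using
    congrArg (algebraMap (MvPowerSeries (Fin 2) ℚ) ValueField) h

theorem kernelCoeff_relation_simple [P.IsReduced] {m : ℕ} (hm : 0 < m) {γ : ι}
    (hγ : γ ∈ b.support) (μ : weightLattice P) :
    kernelCoeff m b μ - valueGen 1 ^ 2 * kernelCoeff m b (μ + rootWeight P γ) =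
      -(kernelCoeff m b (μ - (wtPairing P γ μ + 1) • rootWeight P γ) -
        valueGen 1 ^ 2 * kernelCoeff m b (μ - wtPairing P γ μ • rootWeight P γ)) := by
  have hχ := chi_of_isPos (RootPairing.Base.isPos_of_mem_support hγ)
  simpa [hχ] using
    kernelCoeff_relation hm (isAffineSimple_of_mem_support hγ) μ 0 (by simp [hχ])

/-- Only two cases are used: j = 0, and j = 1 at μ = 0. -/
theorem kernelCoeff_relation_highest {m : ℕ} (hm : 0 < m)
    (hθ : IsHighest b θ) (μ : weightLattice P) (j : ℕ) (hj : wtPairing P θ μ = 1 - j) :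
    (valueGen 0 ^ m) ^ j * (kernelCoeff m b μ -
        valueGen 1 ^ 2 * valueGen 0 ^ m * kernelCoeff m b (μ - rootWeight P θ)) =
      -(kernelCoeff m b (μ + (j : ℤ) • rootWeight P θ) -
        valueGen 1 ^ 2 * valueGen 0 ^ m *
          kernelCoeff m b (μ + (j - 1 : ℤ) • rootWeight P θ)) := by
  have hχ : chi b (P.reflectionPerm θ θ) = 1 := by
    have := chi_reflectionPerm_self b θ
    rw [chi_of_isPos hθ.isPos] at this
    omega
  have hw : rootWeight P (P.reflectionPerm θ θ) = -rootWeight P θ := by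
    rw [rootWeight_reflectionPerm, RootPairing.pairingIn_same]
    module
  have hp : wtPairing P (P.reflectionPerm θ θ) μ = j - 1 := by
    have : wtPairing P (P.reflectionPerm θ θ) μ = -wtPairing P θ μ := by
      have h : (wtPairing P (P.reflectionPerm θ θ) μ : ℚ) = (-wtPairing P θ μ : ℤ) := by
        rw [wtPairing_cast, Int.cast_neg, wtPairing_cast]
        simp
      exact_mod_cast h
    rw [this, hj]
    ring
  have h := kernelCoeff_relation hm hθ.isAffineSimple_neg μ (m * j) (by rw [hχ, hp]; push_cast; ring)
  rw [hχ, hw, hp, mul_one, pow_mul] at h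
  convert h using 5 <;> module

end Cherednik

end

/-! ### Reflection-stable sets of roots, root lengths and the height solution. -/

noncomputable section

namespace Cherednik

open MvPowerSeries
variable {ι E V : Type*} [AddCommGroup E] [Module ℚ E] [AddCommGroup V] [Module ℚ V]
variable {P : RootPairing ι ℚ E V} {b : P.Base} {θ : ι}

section Orbits

variable [P.IsCrystallographic]

/-- By irreducibility S spans E. Were S orthogonal to the coroot of i, the root i would be too,
although that pairing is 2. -/
theorem exists_mem_pairingIn_ne_zero [P.IsIrreducible] {S : Set ι} (hne : S.Nonempty)
    (hS : ∀ j, ∀ k ∈ S, P.reflectionPerm j k ∈ S) (i : ι) :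
    ∃ k ∈ S, P.pairingIn ℤ k i ≠ 0 := by
  by_contra! h
  obtain ⟨k, hk⟩ := hne
  have htop : Submodule.span ℚ (P.root '' S) = ⊤ := by
    refine RootPairing.IsIrreducible.eq_top_of_invtSubmodule_reflection (P := P) _ (fun j => ?_) ?_
    · rw [Module.End.mem_invtSubmodule, Submodule.span_le]
      rintro _ ⟨l, hl, rfl⟩
      exact Submodule.subset_span ⟨_, hS j l hl, by simp⟩
    · intro h0
      have := Submodule.subset_span (R := ℚ) (Set.mem_image_of_mem P.root hk)
      rw [h0] at this
      exact P.ne_zero k this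
  have hle : Submodule.span ℚ (P.root '' S) ≤ LinearMap.ker (P.coroot' i) := by
    rw [Submodule.span_le]
    rintro _ ⟨l, hl, rfl⟩
    have := P.algebraMap_pairingIn ℤ l i
    rw [h l hl, map_zero] at this
    exact this.symm
  have h2 : P.root i ∈ LinearMap.ker (P.coroot' i) := hle (htop ▸ Submodule.mem_top)
  simp at h2

variable [Finite ι] [P.IsReduced]

theorem reflectionPerm_mem_of_forall_simple {S : Set ι}
    (hS : ∀ k ∈ S, ∀ j ∈ b.support, P.reflectionPerm j k ∈ S) (j : ι) :
    ∀ k ∈ S, P.reflectionPerm j k ∈ S := by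
  refine b.induction_reflect j (p := fun j => ∀ k ∈ S, P.reflectionPerm j k ∈ S) ?_
    (fun j hj k hk => hS k hk j hj) ?_
  · intro i hi k hk
    have : P.reflectionPerm (P.reflectionPerm i i) k = P.reflectionPerm i k :=
      P.root.injective (by simp [RootPairing.reflection_reflectionPerm])
    rw [this]
    exact hi k hk
  · intro i j hi hj k hk
    have : P.reflectionPerm (P.reflectionPerm j i) k =
        P.reflectionPerm j (P.reflectionPerm i (P.reflectionPerm j k)) :=
      P.root.injective (by simp [RootPairing.reflection_reflectionPerm])
    rw [this]
    exact hS _ (hi _ (hS k hk j hj)) j hj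

end Orbits

section Norm

variable [Fintype ι] (P)

/-- The squared length of a root. -/
def sqLength (i : ι) : ℚ := P.RootForm (P.root i) (P.root i)

theorem sqLength_pos (i : ι) : 0 < sqLength P i := by
  rw [sqLength, RootPairing.rootForm_root_self]
  refine Finset.sum_pos' (fun j _ => mul_self_nonneg _) ⟨i, Finset.mem_univ _, ?_⟩
  simp

theorem sqLength_reflectionPerm (i j : ι) :
    sqLength P (P.reflectionPerm j i) = sqLength P i := by
  simp [sqLength]

theorem sqLength_induction {p : ι → Prop}
    (h : ∀ i, (∀ j, sqLength P j < sqLength P i → p j) → p i) (i : ι) : p i := by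
  let r : ι → ι → Prop := fun i j => sqLength P i < sqLength P j
  have : IsTrans ι r := ⟨fun _ _ _ h h' => lt_trans h h'⟩
  have : Std.Irrefl r := ⟨fun _ => lt_irrefl _⟩
  exact (Finite.wellFounded_of_trans_of_irrefl r).induction i h

variable [P.IsCrystallographic]

/-- With p = ⟨i, j^∨⟩ one has |k|² = |i|² - (p - 1)|j|². -/
theorem sqLength_lt_of_root_eq_sub {i j k : ι} (hk : P.root k = P.root i - P.root j)
    (h : 2 ≤ P.pairingIn ℤ i j) : sqLength P k < sqLength P i := by
  have h1 : 2 * P.RootForm (P.root i) (P.root j) = P.pairing i j * sqLength P j :=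
    (P.posRootForm ℤ).two_mul_apply_root_root i j
  have h2 : P.RootForm (P.root j) (P.root i) = P.RootForm (P.root i) (P.root j) :=
    P.rootForm_symmetric.eq _ _
  have h3 : (2 : ℚ) ≤ P.pairing i j := by
    rw [← P.algebraMap_pairingIn ℤ, eq_intCast]
    exact_mod_cast h
  have h4 := sqLength_pos P j
  have h5 : sqLength P k = sqLength P i - 2 * P.RootForm (P.root i) (P.root j) + sqLength P j := by
    simp only [sqLength, hk, map_sub, LinearMap.sub_apply, h2]
    ring
  rw [h5, h1]
  nlinarith

end Norm

section Solution

variable {K : Type*} [Field K]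

open Classical in
/-- The function on roots that equals `A s^(-ht α)` on positive and `B s^(-ht α)` on negative
roots. -/
def heightSolution (b : P.Base) (A B s : K) (i : ι) : K :=
  (if b.IsPos i then A else B) * s ^ (-b.height i)

theorem heightSolution_of_isPos {A B s : K} {i : ι} (h : b.IsPos i) :
    heightSolution b A B s i = A * s ^ (-b.height i) := by rw [heightSolution, if_pos h]

theorem heightSolution_of_not_isPos {A B s : K} {i : ι} (h : ¬ b.IsPos i) :
    heightSolution b A B s i = B * s ^ (-b.height i) := by rw [heightSolution, if_neg h]

theorem heightSolution_eq_mul {A B s : K} (hs : s ≠ 0) {i j : ι} (h : b.IsPos i ↔ b.IsPos j) :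
    heightSolution b A B s i = heightSolution b A B s j * s ^ (b.height j - b.height i) := by
  classical
  rw [heightSolution, heightSolution, if_congr h rfl rfl, mul_assoc, ← zpow_add₀ hs]
  congr 2
  ring

variable [P.IsCrystallographic]

theorem rootWeight_of_root_eq_sub {i j k : ι} (hk : P.root k = P.root i - P.root j) :
    rootWeight P k = rootWeight P i - rootWeight P j := Subtype.ext hk

theorem wtPairing_sub_self (i j : ι) :
    wtPairing P j (rootWeight P i - rootWeight P j) = P.pairingIn ℤ i j - 2 := by
  rw [map_sub, wtPairing_rootWeight, wtPairing_rootWeight, RootPairing.pairingIn_same]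

variable [Fintype ι]

/-- The relation at μ = k - α_i involves c at k, s_i k, l = k - α_i and s_i l. For k = α_i the
relation at μ = 0 is used, and matches `hB`. -/
theorem reflect_deviation_simple [P.IsReduced] [CharZero K] {A B s : K} (hs : s ≠ 0)
    {c : weightLattice P → K} (hB : B * s = A + (s - 1) * c 0) {i : ι} (hi : i ∈ b.support)
    (hc : ∀ μ, c μ - s * c (μ + rootWeight P i) =
      -(c (μ - (wtPairing P i μ + 1) • rootWeight P i) -
        s * c (μ - wtPairing P i μ • rootWeight P i)))
    {k : ι} (hk : 0 < P.pairingIn ℤ k i)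
    (hlt : ∀ j, sqLength P j < sqLength P k → c (rootWeight P j) = heightSolution b A B s j) :
    c (rootWeight P (P.reflectionPerm i k)) - heightSolution b A B s (P.reflectionPerm i k) =
      s * (c (rootWeight P k) - heightSolution b A B s k) := by
  have hht := b.height_one_of_mem_support hi
  by_cases hki : k = i
  · subst hki
    have hpos := RootPairing.Base.isPos_of_mem_support hi
    have hneg : ¬ b.IsPos (P.reflectionPerm k k) := by
      rw [RootPairing.Base.isPos_iff, height_neg, hht]
      norm_num
    have h := hc 0
    rw [map_zero] at h
    rw [heightSolution_of_isPos hpos, heightSolution_of_not_isPos hneg, height_neg, hht,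
      rootWeight_reflectionPerm, RootPairing.pairingIn_same]
    simp only [zero_add, zero_smul, sub_zero, one_smul, zero_sub] at h
    rw [show rootWeight P k - (2 : ℤ) • rootWeight P k = -rootWeight P k by module, neg_neg,
      zpow_one, zpow_neg_one, mul_sub, show s * (A * s⁻¹) = A by field_simp]
    linear_combination h - hB
  have hrefl := rootWeight_reflectionPerm (P := P) k i
  have hh := height_reflectionPerm (b := b) k i
  rw [hht, mul_one] at hh
  have hiff : b.IsPos (P.reflectionPerm i k) ↔ b.IsPos k := by
    refine ⟨fun h => ?_, fun h => h.reflectionPerm hi hki⟩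
    rw [RootPairing.Base.isPos_iff] at h ⊢
    omega
  have h := hc (rootWeight P k - rootWeight P i)
  rw [wtPairing_sub_self, sub_add_cancel] at h
  obtain ⟨l, hl⟩ := P.root_sub_root_mem_of_pairingIn_pos hk hki
  have hhl := b.height_sub hl
  rw [hht] at hhl
  have hliff : b.IsPos l ↔ b.IsPos k := by
    refine ⟨fun h => ?_, fun h => h.sub hi hl⟩
    rw [RootPairing.Base.isPos_iff] at h ⊢
    omega
  have hl' := rootWeight_of_root_eq_sub hl
  -- If the pairing is 1, then l = s_i k and the relation reads 2(c(s_i k) - s c(k)) = 0. If it is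
  -- at least 2, then l and s_i l are shorter than k, so `hlt` evaluates them.
  rcases (show P.pairingIn ℤ k i = 1 ∨ 2 ≤ P.pairingIn ℤ k i by omega) with h1 | h2
  · rw [h1] at h hrefl hh
    rw [show rootWeight P k - rootWeight P i - ((1 : ℤ) - 2 + 1) • rootWeight P i =
        rootWeight P k - rootWeight P i by module,
      show rootWeight P k - rootWeight P i - ((1 : ℤ) - 2) • rootWeight P i =
        rootWeight P k by module] at h
    rw [one_smul] at hrefl
    have h3 : c (rootWeight P k - rootWeight P i) = s * c (rootWeight P k) := by
      have : (2 : K) * (c (rootWeight P k - rootWeight P i) - s * c (rootWeight P k)) = 0 := by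
        linear_combination h
      simpa [sub_eq_zero] using this
    rw [hrefl, h3, heightSolution_eq_mul hs hiff, hh, sub_sub_cancel, zpow_one]
    ring
  · have hl2 := sqLength_lt_of_root_eq_sub P hl h2
    have hwl := rootWeight_reflectionPerm (P := P) l i
    have hpl : P.pairingIn ℤ l i = P.pairingIn ℤ k i - 2 := by
      rw [← wtPairing_sub_self, ← hl', wtPairing_rootWeight]
    have hhr := height_reflectionPerm (b := b) l i
    rw [hht, mul_one, hpl] at hhr
    have hriff : b.IsPos (P.reflectionPerm i l) ↔ b.IsPos k := by
      rw [← hiff]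
      refine ⟨fun h => ?_, fun h => ?_⟩
      · rw [hiff]
        rw [RootPairing.Base.isPos_iff] at h ⊢
        omega
      · rw [RootPairing.Base.isPos_iff] at h ⊢
        omega
    rw [hpl, hl'] at hwl
    have e1 := hlt l hl2
    have e2 := hlt (P.reflectionPerm i l) (by rwa [sqLength_reflectionPerm])
    rw [show rootWeight P k - rootWeight P i - (P.pairingIn ℤ k i - 2 + 1) • rootWeight P i =
        rootWeight P (P.reflectionPerm i k) by rw [hrefl]; module, ← hwl, ← hl', e1, e2] at h
    rw [heightSolution_eq_mul hs hliff, hhl, sub_sub_cancel, zpow_one,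
      heightSolution_eq_mul hs hriff] at h
    rw [heightSolution_eq_mul hs hiff, show b.height k - b.height (P.reflectionPerm i k) =
      1 + (b.height k - b.height (P.reflectionPerm i l)) by omega, zpow_one_add₀ hs]
    linear_combination h

end Solution

end Cherednik

end

/-! ### The reflection in the highest root, uniqueness, scalars and exponents. -/

noncomputable section

namespace Cherednik

open MvPowerSeries
variable {ι E V : Type*} [AddCommGroup E] [Module ℚ E] [AddCommGroup V] [Module ℚ V]
variable {P : RootPairing ι ℚ E V} {b : P.Base} {θ : ι} [Fintype ι] [P.IsCrystallographic]

section Solution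

variable {K : Type*} [Field K]

theorem reflect_deviation_highest {A B s q : K} (hs : s ≠ 0) {c : weightLattice P → K}
    (hθ : IsHighest b θ) (hB : B * s = A + (s - 1) * c 0)
    (hA : A = q * s ^ (b.height θ + 1) * B)
    (hc : ∀ μ, wtPairing P θ μ = 1 → c μ = s * q * c (μ - rootWeight P θ))
    (hc' : c (rootWeight P θ) = q * (s - 1) * c 0 + s * q ^ 2 * c (-rootWeight P θ))
    {k : ι} {n : ℕ} (hn : 0 < n) (hk : P.pairingIn ℤ k θ = n) :
    c (rootWeight P k) - heightSolution b A B s k =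
      s * q ^ n * (c (rootWeight P (P.reflectionPerm θ k)) -
        heightSolution b A B s (P.reflectionPerm θ k)) := by
  have hpos : b.IsPos k := by
    by_contra h
    have hneg : b.IsPos (P.reflectionPerm k k) := by
      rw [RootPairing.Base.isPos_iff'] at h ⊢
      rw [height_neg]
      omega
    have := hθ.pairingIn_nonneg hneg
    rw [RootPairing.pairingIn_reflectionPerm_self_left] at this
    omega
  have hh := height_reflectionPerm (b := b) k θ
  have hpos' := hpos
  have hθpos := hθ.isPos
  rw [RootPairing.Base.isPos_iff] at hpos' hθpos
  have hneg : ¬ b.IsPos (P.reflectionPerm θ k) := by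
    rw [RootPairing.Base.isPos_iff, hh, hk]
    have h1 := hθ k
    have h2 := b.height_ne_zero (P.reflectionPerm θ k)
    rw [hh, hk] at h2
    have h3 : b.height θ ≤ n * b.height θ := le_mul_of_one_le_left hθpos.le (by exact_mod_cast hn)
    omega
  have hw := rootWeight_reflectionPerm (P := P) k θ
  rw [heightSolution_of_isPos hpos, heightSolution_of_not_isPos hneg]
  by_cases hkθ : k = θ
  · subst hkθ
    rw [RootPairing.pairingIn_same] at hk
    have h2 : n = 2 := by omega
    subst h2
    rw [RootPairing.pairingIn_same,
      show rootWeight P k - (2 : ℤ) • rootWeight P k = -rootWeight P k by module] at hw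
    rw [hw, hc', height_neg, neg_neg]
    have h4 : A * s ^ (-b.height k) = q * s * B := by
      rw [hA, zpow_add_one₀ hs, zpow_neg]
      field_simp
    have h5 : s * B * s ^ b.height k * q = A := by
      rw [hA, zpow_add_one₀ hs]
      ring
    linear_combination (-1 : K) * h4 + q * h5 - q * hB
  · have h1 : n = 1 := by
      have := hθ.pairingIn_le_one hkθ
      omega
    subst h1
    rw [hk] at hw hh
    rw [hc _ (by rw [wtPairing_rootWeight, hk]; rfl), hw, hh, hA]
    have h2 : s ^ (b.height θ + 1) * s ^ (-b.height k) =
        s * s ^ (-(b.height k - ((1 : ℕ) : ℤ) * b.height θ)) := by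
      rw [← zpow_add₀ hs, ← zpow_one_add₀ hs]
      congr 1
      push_cast
      ring
    simp only [Nat.cast_one, one_smul, pow_one] at h2 ⊢
    linear_combination (-q * B) * h2

theorem eq_heightSolution [P.IsReduced] [P.IsIrreducible] [CharZero K] {A B s q : K} (hs : s ≠ 0)
    (hqs : ∀ n : ℕ, 0 < n → ∀ a : ℤ, q ^ n * s ^ a ≠ 1) {c : weightLattice P → K}
    (hθ : IsHighest b θ) (hB : B * s = A + (s - 1) * c 0)
    (hA : A = q * s ^ (b.height θ + 1) * B)
    (hsimple : ∀ i ∈ b.support, ∀ μ, c μ - s * c (μ + rootWeight P i) =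
      -(c (μ - (wtPairing P i μ + 1) • rootWeight P i) -
        s * c (μ - wtPairing P i μ • rootWeight P i)))
    (hc : ∀ μ, wtPairing P θ μ = 1 → c μ = s * q * c (μ - rootWeight P θ))
    (hc' : c (rootWeight P θ) = q * (s - 1) * c 0 + s * q ^ 2 * c (-rootWeight P θ)) (i : ι) :
    c (rootWeight P i) = heightSolution b A B s i := by
  revert i
  refine sqLength_induction P fun i ih => ?_
  let e : ι → K := fun k => c (rootWeight P k) - heightSolution b A B s k
  suffices h : e i = 0 from sub_eq_zero.mp h
  -- Fixing the length keeps the induction hypothesis available at every member, so S is stable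
  -- under simple reflections and hence under all.
  let S : Set ι := {k | sqLength P k = sqLength P i ∧ ∃ a : ℤ, e k = s ^ a * e i}
  have hstep : ∀ k ∈ S, ∀ j ∈ b.support, P.reflectionPerm j k ∈ S := by
    rintro k ⟨hk, a, ha⟩ j hj
    have hk' := (sqLength_reflectionPerm P k j).trans hk
    refine ⟨hk', ?_⟩
    rcases lt_trichotomy (P.pairingIn ℤ k j) 0 with h | h | h
    · have h1 : 0 < P.pairingIn ℤ (P.reflectionPerm j k) j := by
        rw [← RootPairing.pairingIn_reflectionPerm,
          RootPairing.pairingIn_reflectionPerm_self_right]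
        omega
      have h2 : e _ = s * e _ :=
        reflect_deviation_simple hs hB hj (hsimple j hj) h1 fun l hl => ih l (hk' ▸ hl)
      rw [RootPairing.reflectionPerm_self, ha] at h2
      refine ⟨a - 1, ?_⟩
      rw [zpow_sub_one₀ hs, mul_right_comm, h2]
      field_simp
    · have h1 : P.reflectionPerm j k = k := by
        refine P.reflectionPerm_eq_of_pairing_eq_zero ?_
        rw [← P.algebraMap_pairingIn ℤ, h, map_zero]
      exact ⟨a, by rw [h1, ha]⟩
    · have h2 : e _ = s * e _ :=
        reflect_deviation_simple hs hB hj (hsimple j hj) h fun l hl => ih l (hk ▸ hl)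
      exact ⟨1 + a, by rw [h2, ha, zpow_one_add₀ hs, mul_assoc]⟩
  have hclosed : ∀ j, ∀ k ∈ S, P.reflectionPerm j k ∈ S :=
    reflectionPerm_mem_of_forall_simple hstep
  have hiS : i ∈ S := ⟨rfl, 0, by simp⟩
  obtain ⟨k, hkS, hk⟩ : ∃ k ∈ S, 0 < P.pairingIn ℤ k θ := by
    obtain ⟨k, hkS, hk⟩ := exists_mem_pairingIn_ne_zero ⟨i, hiS⟩ hclosed θ
    rcases lt_or_gt_of_ne hk with h | h
    · refine ⟨_, hclosed θ k hkS, ?_⟩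
      rw [← RootPairing.pairingIn_reflectionPerm, RootPairing.pairingIn_reflectionPerm_self_right]
      omega
    · exact ⟨k, hkS, h⟩
  obtain ⟨n, hn⟩ := Int.eq_ofNat_of_zero_le hk.le
  have hn0 : 0 < n := by omega
  have h : e k = s * q ^ n * e (P.reflectionPerm θ k) :=
    reflect_deviation_highest hs hθ hB hA hc hc' hn0 hn
  obtain ⟨-, a', ha'⟩ := hclosed θ k hkS
  obtain ⟨-, a, ha⟩ := hkS
  rw [ha, ha'] at h
  -- The deviations at k and s_θ k are both powers of s times `e i`; comparing them with the factor
  -- s q^n leaves `e i` times this nonzero scalar.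
  have hne : q ^ n * s ^ (1 + a' - a) - 1 ≠ 0 := sub_ne_zero.mpr (hqs n hn0 _)
  have h2 : s ^ a * ((q ^ n * s ^ (1 + a' - a) - 1) * e i) = 0 := by
    have h3 : s ^ a * s ^ (1 + a' - a) = s * s ^ a' := by
      rw [← zpow_add₀ hs, ← zpow_one_add₀ hs]
      congr 1
      ring
    linear_combination (q ^ n * e i) * h3 - h
  simpa [hne, zpow_ne_zero a hs] using h2

end Solution

section Values

theorem valueGen_ne_zero (i : Fin 2) : valueGen i ≠ 0 := by
  rw [valueGen, Ne, FaithfulSMul.algebraMap_eq_zero_iff]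
  intro h
  simpa using congrArg (coeff (Finsupp.single i 1)) h

theorem valueGen_pow_ne {n : ℕ} (hn : 0 < n) (k : ℕ) : valueGen 0 ^ n ≠ valueGen 1 ^ k := by
  classical
  rw [valueGen, valueGen, ← map_pow, ← map_pow]
  intro h
  have h1 := IsFractionRing.injective (MvPowerSeries (Fin 2) ℚ) ValueField h
  rw [X_pow_eq, X_pow_eq] at h1
  have h2 := congrArg (coeff (Finsupp.single 0 n)) h1
  rw [coeff_monomial_same, coeff_monomial, if_neg] at h2
  · exact one_ne_zero h2
  · intro h3
    have := DFunLike.congr_fun h3 0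
    simp at this
    omega

theorem valueGen_pow_mul_zpow_ne_one {n : ℕ} (hn : 0 < n) (a : ℤ) :
    valueGen 0 ^ n * valueGen 1 ^ a ≠ 1 := by
  intro h
  obtain ⟨k, rfl | rfl⟩ := a.eq_nat_or_neg
  · rw [zpow_natCast, valueGen, valueGen, ← map_pow, ← map_pow, ← map_mul,
      ← map_one (algebraMap (MvPowerSeries (Fin 2) ℚ) ValueField)] at h
    have h1 := congrArg constantCoeff (IsFractionRing.injective (MvPowerSeries (Fin 2) ℚ) _ h)
    simp [hn.ne'] at h1
  · rw [zpow_neg, zpow_natCast, mul_inv_eq_one₀ (pow_ne_zero _ (valueGen_ne_zero 1))] at h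
    exact valueGen_pow_ne hn k h

theorem emb_gen (i : Fin 2) : emb (gen i) = valueGen i := by
  rw [emb, gen, valueGen]
  erw [IsLocalization.map_eq]
  simp

theorem pairing_expo_one (m : ℕ) (b : P.Base) (μ : weightLattice P) :
    pairing m b (expo μ) 1 = kernelCoeff m b (-μ) := by
  have h1 : iotaPoly (bar (1 : Poly P)) = 1 := by
    rw [iotaPoly, bar, map_one, map_one]
  rw [pairing, h1, mul_one, constantTerm, expo, AddMonoidAlgebra.coeff_single,
    Finsupp.sum_single_index (by simp), map_one, one_mul, kernelCoeff]

end Values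

section Exponents

/-- A positive non-simple root stays a root after subtracting a simple root with which it pairs
positively, so heights descend in steps of 1. -/
theorem exists_height_eq {j : ι} {n : ℕ} (h1 : 1 ≤ n) (hn : (n : ℤ) ≤ b.height j) : ∃ i, b.height i = n := by
  obtain ⟨d, hd⟩ : ∃ d : ℕ, b.height j = n + d := ⟨(b.height j - n).toNat, by omega⟩
  clear hn
  have key : ∀ d : ℕ, ∀ k, b.height k = n + d → ∃ i, b.height i = n := by
    intro d
    induction d with
    | zero => exact fun k hk => ⟨k, by simpa using hk⟩
    | succ d ih =>
      intro k hk
      have hkpos : b.IsPos k := by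
        rw [RootPairing.Base.isPos_iff]
        omega
      obtain ⟨j, hj, hj'⟩ := hkpos.exists_mem_support_pos_pairingIn
      rw [P.zero_lt_pairingIn_iff'] at hj'
      have hne : k ≠ j := by
        rintro rfl
        have := b.height_one_of_mem_support hj
        omega
      obtain ⟨l, hl⟩ := P.root_sub_root_mem_of_pairingIn_pos hj' hne
      refine ih l ?_
      rw [b.height_sub hl, hk, b.height_one_of_mem_support hj]
      push_cast
      ring
  exact key d j hd

/-- For k = r the threshold r + 1 - k is 1, so d_r counts the heights that occur, namely 1, …, ht θ.
-/
theorem IsHighest.exponent_eq (hθ : IsHighest b θ) :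
    (exponent b (Module.finrank ℚ E) : ℤ) = b.height θ := by
  have hpos := hθ.isPos
  rw [RootPairing.Base.isPos_iff] at hpos
  obtain ⟨N, hN⟩ := Int.eq_ofNat_of_zero_le hpos.le
  have h : ∀ n : ℕ, (1 ≤ n ∧ Module.finrank ℚ E + 1 - Module.finrank ℚ E ≤ heightCount b n) ↔
      n ∈ Finset.Icc 1 N := by
    intro n
    rw [Finset.mem_Icc, Nat.add_sub_cancel_left, heightCount, Nat.one_le_iff_ne_zero (n := Nat.card _),
      Nat.card_ne_zero]
    refine and_congr_right fun h1 => ⟨fun h => ?_, fun h => ⟨?_, inferInstance⟩⟩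
    · obtain ⟨i, hi⟩ := h.1
      have := hθ i
      omega
    · obtain ⟨i, hi⟩ := exists_height_eq (b := b) (j := θ) h1 (by omega)
      exact ⟨i, hi⟩
  rw [exponent, Nat.card_congr (Equiv.subtypeEquivRight h), hN, Nat.card_eq_fintype_card,
    Fintype.card_coe, Nat.card_Icc, Nat.add_sub_cancel]

end Exponents

end Cherednik

end

/-! ### Assembly of the formula. -/

noncomputable section

namespace Cherednik

variable {ι E V : Type*} [Fintype ι] [AddCommGroup E] [Module ℚ E] [AddCommGroup V] [Module ℚ V]

instance : CharZero ValueField :=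
  charZero_of_injective_ringHom
    ((algebraMap (MvPowerSeries (Fin 2) ℚ) ValueField).comp MvPowerSeries.C).injective

theorem pairing_expo_neg_rootWeight (P : RootPairing ι ℚ E V) [P.IsRootSystem]
    [P.IsCrystallographic] [P.IsReduced] [P.IsIrreducible] (b : P.Base)
    (m : ℕ) (hm : 0 < m) (i : ι) (hi : b.IsPos i) :
    pairing m b (expo (-rootWeight P i)) 1 =
      emb
        (q m *
          t ^ (2 * b.height i -
            2 * ((exponent b (Module.finrank ℚ E) : ℤ) + 1)) *
          ((t ^ 2 - 1) /
            (q m *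
              t ^ (-2 * (exponent b (Module.finrank ℚ E) : ℤ)) - 1))) *
      pairing m b 1 1 := by
  have : Nonempty ι := ⟨i⟩
  obtain ⟨θ, hθ⟩ := exists_isHighest b
  have hT := valueGen_ne_zero 1
  have hone : pairing m b 1 1 = kernelCoeff m b 0 := by
    have h := pairing_expo_one m b 0
    rwa [neg_zero] at h
  rw [pairing_expo_one, neg_neg, hone, hθ.exponent_eq]
  simp only [map_mul, map_sub, map_div₀, map_pow, map_zpow₀, map_one, q, t,
    map_inv₀, emb_gen]
  have hrel1 := kernelCoeff_relation_highest hm hθ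
  have hsimple : ∀ j ∈ b.support, ∀ μ, _ := fun j hj μ => kernelCoeff_relation_simple hm hj μ
  have hpow : ∀ n : ℕ, 0 < n → ∀ a : ℤ, (valueGen 0 ^ m) ^ n * valueGen 1 ^ a ≠ 1 := by
    intro n hn a
    rw [← pow_mul]
    exact valueGen_pow_mul_zpow_ne_one (Nat.mul_pos hm hn) a
  generalize kernelCoeff m b = c at *
  generalize valueGen 0 ^ m = Q at *
  generalize valueGen 1 = T at *
  have hs : T ^ 2 ≠ 0 := pow_ne_zero _ hT
  have hsz : ∀ a : ℤ, (T ^ 2) ^ a = T ^ (2 * a) := fun a => by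
    rw [zpow_mul]
    norm_cast
  have hden : 1 - Q * (T ^ 2) ^ b.height θ ≠ 0 := by
    rw [sub_ne_zero, hsz]
    simpa using (hpow 1 one_pos (2 * b.height θ)).symm
  -- With s = T² = t⁻², these values of A and B solve B s = A + (s - 1) c(0) and A = Q s^{ht θ + 1}
  -- B.
  have hB : (T ^ 2 - 1) * c 0 / (T ^ 2 * (1 - Q * (T ^ 2) ^ b.height θ)) * T ^ 2 =
      Q * (T ^ 2 - 1) * (T ^ 2) ^ b.height θ * c 0 / (1 - Q * (T ^ 2) ^ b.height θ) +
        (T ^ 2 - 1) * c 0 := by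
    field_simp
    ring
  have hA : Q * (T ^ 2 - 1) * (T ^ 2) ^ b.height θ * c 0 / (1 - Q * (T ^ 2) ^ b.height θ) =
      Q * (T ^ 2) ^ (b.height θ + 1) *
        ((T ^ 2 - 1) * c 0 / (T ^ 2 * (1 - Q * (T ^ 2) ^ b.height θ))) := by
    rw [zpow_add_one₀ hs]
    field_simp
  have hmain := eq_heightSolution (b := b) hs (q := Q) (c := c) ?_ hθ hB hA hsimple ?_ ?_ i
  · rw [hmain, heightSolution_of_isPos hi, inv_zpow', inv_zpow']
    rw [show -(2 * b.height i - 2 * (b.height θ + 1)) =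
      2 * b.height θ + 2 * (-b.height i) + 2 by ring, zpow_add₀ hT, zpow_add₀ hT,
      show -(-2 * b.height θ) = 2 * b.height θ by ring, ← hsz, ← hsz,
      show T ^ (2 : ℤ) = T ^ 2 by norm_cast]
    rw [show Q * (T ^ 2) ^ b.height θ - 1 = -(1 - Q * (T ^ 2) ^ b.height θ) by ring]
    field_simp
    ring
  · intro n hn a
    rw [hsz]
    exact hpow n hn _
  · intro μ hμ
    have h := hrel1 μ 0 (by simpa using hμ)
    simp only [pow_zero, one_mul, Nat.cast_zero, zero_smul, add_zero, zero_sub, neg_smul,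
      one_smul, ← sub_eq_add_neg] at h
    have h2 : (2 : ValueField) * (c μ - T ^ 2 * Q * c (μ - rootWeight P θ)) = 0 := by
      linear_combination h
    simpa [sub_eq_zero] using h2
  · have h := hrel1 0 1 (by simp)
    simp only [pow_one, Nat.cast_one, one_smul, zero_add, zero_sub, sub_self, zero_smul] at h
    linear_combination h

end Cherednik

end

theorem mainTheorem6 {ι E V : Type*} [Fintype ι] [AddCommGroup E] [Module ℚ E]
    [AddCommGroup V] [Module ℚ V] (P : RootPairing ι ℚ E V) [P.IsRootSystem]
    [P.IsCrystallographic] [P.IsReduced] [P.IsIrreducible] (b : P.Base)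
    (m : ℕ) (hm : 0 < m) (i : ι) (hi : b.IsPos i) :
    Cherednik.pairing m b (Cherednik.expo (-Cherednik.rootWeight P i)) 1 =
      Cherednik.emb
        (Cherednik.q m *
          Cherednik.t ^ (2 * b.height i -
            2 * ((Cherednik.exponent b (Module.finrank ℚ E) : ℤ) + 1)) *
          ((Cherednik.t ^ 2 - 1) /
            (Cherednik.q m *
              Cherednik.t ^ (-2 * (Cherednik.exponent b (Module.finrank ℚ E) : ℤ)) - 1))) *
      Cherednik.pairing m b 1 1 :=
  Cherednik.pairing_expo_neg_rootWeight P b m hm i hi
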